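/- Let $M$ be a globally hyperbolic spacetime (a time-oriented Lorentzian manifold of signature $(+,-,\dots,-)$ without closed causal curves, in which every compact set $S$ has compact causal hull $\mathrm{ch}(S)=J^+(S)\cap J^-(S)$). A region is an open set $O$ with $\mathrm{ch}(O)=O$. A QFT $\mathscr A$ on $M$ is a unital complex $*$-algebra $\mathscr A(M)$ with unital $*$-subalgebras $\mathscr A(M;O)$ for all regions $O$, $\mathscr A(M;M)=\mathscr A(M)$, satisfying isotony, Einstein causality ($\mathscr A(M;O_1)$ and $\mathscr A(M;O_2)$ commute if $O_1\cap J(O_2)=\emptyset$, where $J(O)=J^+(O)\cup J^-(O)$) and the timeslice axiom ($\mathscr A(M;O_1)=\mathscr A(M;O_2)$ if $O_1\subset O_2$ and $O_1$ contains a Cauchy surface of $M$). Tensor products of QFTs are algebraic and formed region by region. A set $K\subset M$ is temporally compact if it lies strictly between two Cauchy surfaces of $M$ and $J^\pm(K)$ are closed. A coupled combination of QFTs $\mathscr A$ and $\mathscr B$ with temporally compact coupling zone $K$ is a QFT $\mathscr C$ with $*$-isomorphisms $\iota_O:(\mathscr A\otimes\mathscr B)(M;O)\to\mathscr C(M;O)$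 for all regions $O\subset M\setminus\mathrm{ch}(K)$, compatible with the inclusions of local algebras. With $M^\pm=M\setminus J^\mp(K)$, the timeslice axiom and $\iota_{M^\pm}$ give $*$-isomorphisms $\tau^\pm:(\mathscr A\otimes\mathscr B)(M)\to\mathscr C(M)$, and the scattering map is $\Theta=(\tau^-)^{-1}\circ\tau^+$. For states $\omega$ on $\mathscr A(M)$ and $\sigma$ on $\mathscr B(M)$ and an effect $F\in\mathscr B(M)$ (both $F$ and $\mathbb 1-F$ are finite sums of elements $Z^*Z$), put $$\mathscr I_\sigma(F)(\omega)(A)=(\omega\otimes\sigma)(\Theta(A\otimes F)),\qquad \mathrm P_\sigma(F;\omega)=\mathscr I_\sigma(F)(\omega)(\mathbb 1);$$ the selective update of $\omega$ after a successful test of $F$ is $\mathscr I_\sigma(F)(\omega)/\mathrm P_\sigma(F;\omega)$. Write $K\triangleleft K'$ if $K\cap J^+(K')=\emptyset$. Let $\mathscr A$ be a system QFT and $\mathscr B_1,\dots,\mathscr B_n$ probe QFTs. For each $j$ let $\mathscr C_j$ be a coupled combination of $\mathscr A$ and $\mathscr B_j$ with coupling zone $K_j$ and scattering map $\Theta_j$.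 For each $S\subset\{1,\dots,n\}$ let $\mathscr C_S$ be a (merged) coupled combination of $\mathscr A$ and $\mathscr B_S=\bigotimes_{i\in S}\mathscr B_i$ with coupling zone $K_S=\bigcup_{i\in S}K_i$ and scattering map $\Theta_S$. Assume causal factorisation: whenever $j\notin S$ and $K_S\triangleleft K_j$, $$\Theta_{S\cup\{j\}}=(\Theta_S\otimes\mathrm{id}_{\mathscr B_j})\circ(\Theta_j\otimes_2\mathrm{id}_{\mathscr B_S})\quad\text{on }\ \mathscr A(M)\otimes\mathscr B_S(M)\otimes\mathscr B_j(M)\cong\mathscr A(M)\otimes\mathscr B_{S\cup\{j\}}(M),$$ where $\Theta_j\otimes_2\mathrm{id}$ acts as $\Theta_j$ on the first and third factors. Let $\omega$ be a state on $\mathscr A(M)$, and for each $j$ let $\sigma_j$ be a state on $\mathscr B_j(M)$ and $E_j\in\mathscr B_j(M)$ an effect. Let $$\mathrm P_{\sigma_1\otimes\cdots\otimes\sigma_n}(E_1\&\cdots\&E_n;\omega)=(\omega\otimes\sigma_1\otimes\cdots\otimes\sigma_n)\bigl(\Theta_{\{1,\dots,n\}}(\mathbb 1\otimes E_1\otimes\cdots\otimes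 E_n)\bigr)$$ be the joint success probability. Let $\pi$ be any compatible causal order, that is, a permutation of $\{1,\dots,n\}$ with $K_{\pi(r)}\triangleleft K_{\pi(s)}$ for all $r<s$. Let $\omega^{(0)}=\omega$ and let $\omega^{(r)}$ be the selective update of $\omega^{(r-1)}$ after a successful test of $E_{\pi(r)}$. Then $\omega^{(r)}$ is a state as long as the preceding single-test probabilities are nonzero, and $$\mathrm P_{\sigma_1\otimes\cdots\otimes\sigma_n}(E_1\&\cdots\&E_n;\omega)=\mathrm P_{\sigma_{\pi(n)}}(E_{\pi(n)};\omega^{(n-1)})\cdots\mathrm P_{\sigma_{\pi(2)}}(E_{\pi(2)};\omega^{(1)})\,\mathrm P_{\sigma_{\pi(1)}}(E_{\pi(1)};\omega),$$ where the right-hand side is read as $0$ if one of the factors vanishes (the later updates are then undefined). In particular, any two compatible causal orders give the same product. -/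

import Mathlib

open scoped Manifold ContDiff TensorProduct ComplexOrder

noncomputable section

namespace MeasurementQFT

universe v u

/-! ### Globally hyperbolic spacetimes -/

/-- A smooth Lorentzian metric of signature `(+,-,…,-)`. -/
structure LorentzianMetric (d : ℕ) (M : Type v) [TopologicalSpace M]
    [ChartedSpace (EuclideanSpace ℝ (Fin d)) M] [IsManifold (𝓡 d) ∞ M] where
  /-- The bilinear form on each tangent space. -/
  form (x : M) : TangentSpace (𝓡 d) x →L[ℝ] TangentSpace (𝓡 d) x →L[ℝ] ℝ
  symm (x : M) (v w : TangentSpace (𝓡 d) x) : form x v w = form x w v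
  signature (x : M) : ∃ v : TangentSpace (𝓡 d) x, 0 < form x v v ∧
    ∀ w : TangentSpace (𝓡 d) x, form x v w = 0 → w ≠ 0 → form x w w < 0
  contMDiff : ContMDiff (𝓡 d)
    ((𝓡 d).prod 𝓘(ℝ, EuclideanSpace ℝ (Fin d) →L[ℝ] EuclideanSpace ℝ (Fin d) →L[ℝ] ℝ)) ∞
    (fun x ↦ Bundle.TotalSpace.mk'
      (EuclideanSpace ℝ (Fin d) →L[ℝ] EuclideanSpace ℝ (Fin d) →L[ℝ] ℝ)
      (E := fun x ↦ TangentSpace (𝓡 d) x →L[ℝ] TangentSpace (𝓡 d) x →L[ℝ] ℝ) x (form x))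

/-- A manifold with a Lorentzian metric and a time orientation; the latter is given by a
continuous timelike vector field. -/
structure TimeOrientedSpacetime (d : ℕ) (M : Type v) [TopologicalSpace M]
    [ChartedSpace (EuclideanSpace ℝ (Fin d)) M] [IsManifold (𝓡 d) ∞ M] where
  metric : LorentzianMetric d M
  timeField (x : M) : TangentSpace (𝓡 d) x
  timeField_timelike (x : M) : 0 < metric.form x (timeField x) (timeField x)
  timeField_continuous : Continuous fun x ↦ (⟨x, timeField x⟩ : TangentBundle (𝓡 d) M)

section Causality

variable {d : ℕ} {M : Type v} [TopologicalSpace M]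
  [ChartedSpace (EuclideanSpace ℝ (Fin d)) M] [IsManifold (𝓡 d) ∞ M]

namespace TimeOrientedSpacetime

variable (X : TimeOrientedSpacetime d M)

/-- Future-directed causal tangent vectors (automatically nonzero). -/
def FutureCausal (x : M) (w : TangentSpace (𝓡 d) x) : Prop :=
  0 ≤ X.metric.form x w w ∧ 0 < X.metric.form x (X.timeField x) w

/-- Future-directed timelike tangent vectors. -/
def FutureTimelike (x : M) (w : TangentSpace (𝓡 d) x) : Prop :=
  0 < X.metric.form x w w ∧ 0 < X.metric.form x (X.timeField x) w

/-- The velocity at `t` of a curve considered on the parameter set `s`. -/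
def velocity (γ : ℝ → M) (s : Set ℝ) (t : ℝ) : TangentSpace (𝓡 d) (γ t) :=
  mfderivWithin 𝓘(ℝ, ℝ) (𝓡 d) γ s t (1 : ℝ)

/-- There is a smooth future-directed causal curve from `p` to `q`. -/
def CausalStep (p q : M) : Prop :=
  ∃ γ : ℝ → M, γ 0 = p ∧ γ 1 = q ∧ ContMDiffOn 𝓘(ℝ, ℝ) (𝓡 d) ∞ γ (Set.Icc 0 1) ∧
    ∀ t ∈ Set.Icc (0 : ℝ) 1, X.FutureCausal (γ t) (velocity γ (Set.Icc 0 1) t)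

/-- `q` is reached from `p` by a (possibly trivial) piecewise smooth future-directed causal
curve, i.e. by a finite concatenation of smooth ones. -/
def CausalLE : M → M → Prop := Relation.ReflTransGen X.CausalStep

/-- The causal future `J⁺(S)`. -/
def Jplus (S : Set M) : Set M := {q | ∃ p ∈ S, X.CausalLE p q}

/-- The causal past `J⁻(S)`. -/
def Jminus (S : Set M) : Set M := {p | ∃ q ∈ S, X.CausalLE p q}

/-- `J(S) = J⁺(S) ∪ J⁻(S)`. -/
def J (S : Set M) : Set M := X.Jplus S ∪ X.Jminus S

/-- The causal hull `ch(S) = J⁺(S) ∩ J⁻(S)`. -/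
def hull (S : Set M) : Set M := X.Jplus S ∩ X.Jminus S

/-- No closed causal curves, and compact sets have compact causal hulls. -/
def GloballyHyperbolic : Prop :=
  (∀ p, ¬ Relation.TransGen X.CausalStep p p) ∧ ∀ S : Set M, IsCompact S → IsCompact (X.hull S)

/-- The restriction of `γ` to `[a, b]` is smooth, timelike and future-directed. -/
def SmoothTimelikeOn (γ : ℝ → M) (a b : ℝ) : Prop :=
  ContMDiffOn 𝓘(ℝ, ℝ) (𝓡 d) ∞ γ (Set.Icc a b) ∧
    ∀ t ∈ Set.Icc a b, X.FutureTimelike (γ t) (velocity γ (Set.Icc a b) t)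

/-- `γ : ℝ → M` is an inextendible, piecewise smooth, future-directed timelike curve: it is
smooth and timelike up to finitely many break points on every compact interval, and has no
limit at either end. Any inextendible timelike curve can be reparametrised over `ℝ`. -/
def InextendibleTimelike (γ : ℝ → M) : Prop :=
  (∀ t, ∃ a b, a < t ∧ t < b ∧ X.SmoothTimelikeOn γ a t ∧ X.SmoothTimelikeOn γ t b) ∧
    (∀ p, ¬ Filter.Tendsto γ Filter.atTop (nhds p)) ∧
    ∀ p, ¬ Filter.Tendsto γ Filter.atBot (nhds p)

/-- A Cauchy surface is met exactly once by every inextendible timelike curve. -/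
def IsCauchySurface (S : Set M) : Prop :=
  ∀ γ : ℝ → M, X.InextendibleTimelike γ → ∃! t, γ t ∈ S

end TimeOrientedSpacetime

end Causality

/-- Globally hyperbolic spacetimes. -/
structure GHSpacetime (d : ℕ) (M : Type v) [TopologicalSpace M]
    [ChartedSpace (EuclideanSpace ℝ (Fin d)) M] [IsManifold (𝓡 d) ∞ M]
    extends TimeOrientedSpacetime d M where
  globallyHyperbolic : toTimeOrientedSpacetime.GloballyHyperbolic

section Regions

variable {d : ℕ} {M : Type v} [TopologicalSpace M]
  [ChartedSpace (EuclideanSpace ℝ (Fin d)) M] [IsManifold (𝓡 d) ∞ M]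

/-- Regions: causally convex open subsets. -/
@[ext] structure Region (X : GHSpacetime d M) where
  carrier : Set M
  isOpen : IsOpen carrier
  causallyConvex : X.hull carrier = carrier

theorem subset_hull (X : GHSpacetime d M) (S : Set M) : S ⊆ X.hull S :=
  fun p hp ↦ ⟨⟨p, hp, .refl⟩, ⟨p, hp, .refl⟩⟩

/-- `M` itself as a region. -/
def Region.whole (X : GHSpacetime d M) : Region X where
  carrier := Set.univ
  isOpen := isOpen_univ
  causallyConvex := Set.eq_univ_of_univ_subset (subset_hull X _)

/-- `K` is temporally compact: it lies in the open region between two Cauchy surfaces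
`Σ⁻` and `Σ⁺`. The sets `J^±(K)` are required to be closed, so that `M^± = M \ J^∓(K)` are open;
for closed (in particular compact) `K` this is automatic. -/
structure TemporallyCompact (X : GHSpacetime d M) (K : Set M) : Prop where
  isClosed_Jplus : IsClosed (X.Jplus K)
  isClosed_Jminus : IsClosed (X.Jminus K)
  bounded_past : ∃ S, X.IsCauchySurface S ∧ Disjoint K (X.Jminus S)
  bounded_future : ∃ S, X.IsCauchySurface S ∧ Disjoint K (X.Jplus S)

/-- `K₁ ◁ K₂`, i.e. `K₁ ∩ J⁺(K₂) = ∅`. -/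
def Precedes (X : GHSpacetime d M) (K₁ K₂ : Set M) : Prop := K₁ ∩ X.Jplus K₂ = ∅

/-- The sets `K 0, …, K (n-1)` are causally ordered: `K i ◁ K j` whenever `i < j`. -/
def CausallyOrdered (X : GHSpacetime d M) {n : ℕ} (K : Fin n → Set M) : Prop :=
  ∀ i j, i < j → Precedes X (K i) (K j)

/-- The `out` region `M⁺ = M \ J⁻(K)`. -/
def outRegion (X : GHSpacetime d M) (K : Set M) (hK : TemporallyCompact X K) : Region X where
  carrier := (X.Jminus K)ᶜ
  isOpen := hK.isClosed_Jminus.isOpen_compl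
  causallyConvex := by
    refine Set.Subset.antisymm ?_ (subset_hull X _)
    rintro r ⟨⟨p, hp, hpr⟩, -⟩ ⟨k, hk, hrk⟩
    exact hp ⟨k, hk, Relation.ReflTransGen.trans hpr hrk⟩

/-- The `in` region `M⁻ = M \ J⁺(K)`. -/
def inRegion (X : GHSpacetime d M) (K : Set M) (hK : TemporallyCompact X K) : Region X where
  carrier := (X.Jplus K)ᶜ
  isOpen := hK.isClosed_Jplus.isOpen_compl
  causallyConvex := by
    refine Set.Subset.antisymm ?_ (subset_hull X _)
    rintro r ⟨-, ⟨q, hq, hrq⟩⟩ ⟨k, hk, hkr⟩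
    exact hq ⟨k, hk, Relation.ReflTransGen.trans hkr hrq⟩

theorem outRegion_cauchy (X : GHSpacetime d M) (K : Set M) (hK : TemporallyCompact X K) :
    ∃ S, X.IsCauchySurface S ∧ S ⊆ (outRegion X K hK).carrier := by
  obtain ⟨S, hS, hd⟩ := hK.bounded_future
  refine ⟨S, hS, ?_⟩
  rintro s hs ⟨k, hk, hsk⟩
  exact Set.disjoint_left.1 hd hk ⟨s, hs, hsk⟩

theorem inRegion_cauchy (X : GHSpacetime d M) (K : Set M) (hK : TemporallyCompact X K) :
    ∃ S, X.IsCauchySurface S ∧ S ⊆ (inRegion X K hK).carrier := by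
  obtain ⟨S, hS, hd⟩ := hK.bounded_past
  refine ⟨S, hS, ?_⟩
  rintro s hs ⟨k, hk, hks⟩
  exact Set.disjoint_left.1 hd hk ⟨s, hs, hks⟩

theorem outRegion_subset (X : GHSpacetime d M) (K : Set M) (hK : TemporallyCompact X K) :
    (outRegion X K hK).carrier ⊆ (X.hull K)ᶜ := fun _ hp h ↦ hp h.2

theorem inRegion_subset (X : GHSpacetime d M) (K : Set M) (hK : TemporallyCompact X K) :
    (inRegion X K hK).carrier ⊆ (X.hull K)ᶜ := fun _ hp h ↦ hp h.1

end Regions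

/-! ### Finite tensor products of unital `*`-algebras -/

section PiStar

variable {ι : Type} {A : ι → Type u} [∀ i, Ring (A i)] [∀ i, Algebra ℂ (A i)]
  [∀ i, StarRing (A i)] [∀ i, StarModule ℂ (A i)]

/-- The conjugate-linear involution `⨂ aᵢ ↦ ⨂ aᵢ*`. -/
def piStar : (⨂[ℂ] i, A i) →+ (⨂[ℂ] i, A i) :=
  PiTensorProduct.liftAddHom
    (fun p : ℂ × (∀ i, A i) ↦ star p.1 • PiTensorProduct.tprod ℂ (fun i ↦ star (p.2 i)))
    (fun z f i hf ↦ by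
      have : PiTensorProduct.tprod ℂ (fun i ↦ star (f i)) = 0 :=
        MultilinearMap.map_coord_zero _ i (by simp [hf])
      simp [this])
    (fun f ↦ by simp)
    (fun z f i m₁ m₂ ↦ by
      have h (m : A i) : (fun k ↦ star (Function.update f i m k)) =
          Function.update (fun k ↦ star (f k)) i (star m) := by
        funext k
        by_cases hk : k = i
        · subst hk; simp
        · simp [hk]
      simp only [h, star_add, MultilinearMap.map_update_add, smul_add])
    (fun z₁ z₂ f ↦ by simp [add_smul])
    (fun z f i r ↦ by
      have h (m : A i) : (fun k ↦ star (Function.update f i m k)) =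
          Function.update (fun k ↦ star (f k)) i (star m) := by
        funext k
        by_cases hk : k = i
        · subst hk; simp
        · simp [hk]
      have h' : (fun k ↦ star (f k)) = Function.update (fun k ↦ star (f k)) i (star (f i)) := by
        simp
      simp only [h, star_smul, MultilinearMap.map_update_smul, star_mul', smul_smul]
      rw [← h', mul_comm])

instance piTensorStar : Star (⨂[ℂ] i, A i) where
  star x := piStar x

theorem star_smul_tprod (z : ℂ) (f : ∀ i, A i) :
    star (z • PiTensorProduct.tprod ℂ f) =
      star z • PiTensorProduct.tprod ℂ (fun i ↦ star (f i)) := by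
  rw [← PiTensorProduct.tprodCoeff_eq_smul_tprod]
  exact rfl

@[simp] theorem star_tprod (f : ∀ i, A i) :
    star (PiTensorProduct.tprod ℂ f) = PiTensorProduct.tprod ℂ (fun i ↦ star (f i)) := by
  simpa using star_smul_tprod 1 f

theorem star_add_pi (x y : ⨂[ℂ] i, A i) : star (x + y) = star x + star y :=
  map_add piStar x y

instance piTensorStarRing : StarRing (⨂[ℂ] i, A i) where
  star_involutive x := by
    induction x using PiTensorProduct.induction_on with
    | smul_tprod z f => simp [star_smul_tprod]
    | add x y hx hy => rw [star_add_pi, star_add_pi, hx, hy]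
  star_mul x y := by
    induction x using PiTensorProduct.induction_on with
    | smul_tprod z f =>
      induction y using PiTensorProduct.induction_on with
      | smul_tprod w g =>
        rw [PiTensorProduct.smul_tprod_mul_smul_tprod]
        simp only [star_smul_tprod]
        rw [PiTensorProduct.smul_tprod_mul_smul_tprod, star_mul]
        congr 2
        funext i
        exact star_mul _ _
      | add x y hx hy => rw [mul_add, star_add_pi, star_add_pi, hx, hy, add_mul]
    | add x y hx hy => rw [add_mul, star_add_pi, star_add_pi, hx, hy, mul_add]
  star_add := star_add_pi

instance piTensorStarModule : StarModule ℂ (⨂[ℂ] i, A i) where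
  star_smul z x := by
    induction x using PiTensorProduct.induction_on with
    | smul_tprod w f => rw [smul_smul, star_smul_tprod, star_smul_tprod, smul_smul, star_mul']
    | add x y hx hy => rw [smul_add, star_add_pi, star_add_pi, hx, hy, smul_add]

end PiStar

/-! ### Quantum field theories -/

section QFT

variable {d : ℕ} {M : Type v} [TopologicalSpace M]
  [ChartedSpace (EuclideanSpace ℝ (Fin d)) M] [IsManifold (𝓡 d) ∞ M]

/-- A QFT on `M`: the unital `*`-algebra `𝒜(M)` with its local subalgebras `𝒜(M;O)`. -/
structure QFT (X : GHSpacetime d M) where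
  /-- The global algebra `𝒜(M)`. -/
  alg : Type u
  [ring : Ring alg]
  [algebra : Algebra ℂ alg]
  [starRing : StarRing alg]
  [starModule : StarModule ℂ alg]
  /-- The local algebras `𝒜(M;O)`. -/
  loc : Region X → StarSubalgebra ℂ alg
  loc_whole : loc (Region.whole X) = ⊤
  isotony : ∀ O₁ O₂ : Region X, O₁.carrier ⊆ O₂.carrier → loc O₁ ≤ loc O₂
  einstein : ∀ O₁ O₂ : Region X, O₁.carrier ∩ X.J O₂.carrier = ∅ →
    ∀ a ∈ loc O₁, ∀ b ∈ loc O₂, a * b = b * a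
  timeslice : ∀ O₁ O₂ : Region X, O₁.carrier ⊆ O₂.carrier →
    (∃ S, X.IsCauchySurface S ∧ S ⊆ O₁.carrier) → loc O₁ = loc O₂

attribute [instance] QFT.ring QFT.algebra QFT.starRing QFT.starModule

theorem QFT.loc_eq_top {X : GHSpacetime d M} (A : QFT.{v, u} X) (O : Region X)
    (hO : ∃ S, X.IsCauchySurface S ∧ S ⊆ O.carrier) : A.loc O = ⊤ :=
  (A.timeslice O (Region.whole X) (Set.subset_univ _) hO).trans A.loc_whole

theorem commute_adjoin {R : Type u} [Ring R] [Algebra ℂ R] [StarRing R] [StarModule ℂ R]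
    {s t : Set R} (ht : ∀ b ∈ t, star b ∈ t)
    (h : ∀ a ∈ s, ∀ b ∈ t, a * b = b * a) :
    ∀ a ∈ StarAlgebra.adjoin ℂ s, ∀ b ∈ StarAlgebra.adjoin ℂ t, a * b = b * a := by
  have h1 : StarAlgebra.adjoin ℂ s ≤ StarSubalgebra.centralizer ℂ t := by
    refine StarAlgebra.adjoin_le fun a ha ↦ ?_
    refine (StarSubalgebra.mem_centralizer_iff ℂ).2 fun b hb ↦ ?_
    exact ⟨(h a ha b hb).symm, (h a ha _ (ht b hb)).symm⟩
  have h2 : StarAlgebra.adjoin ℂ t ≤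
      StarSubalgebra.centralizer ℂ (StarAlgebra.adjoin ℂ s : Set R) := by
    refine StarAlgebra.adjoin_le fun b hb ↦ ?_
    refine (StarSubalgebra.mem_centralizer_iff ℂ).2 fun a ha ↦ ?_
    exact ⟨(((StarSubalgebra.mem_centralizer_iff ℂ).1 (h1 ha)) b hb).1.symm,
      (((StarSubalgebra.mem_centralizer_iff ℂ).1 (h1 (star_mem ha))) b hb).1.symm⟩
  intro a ha b hb
  exact (((StarSubalgebra.mem_centralizer_iff ℂ).1 (h2 hb)) a ha).1

/-- The uncoupled combination `𝒜 ⊗ ℬ`, with local algebras `𝒜(M;O) ⊗ ℬ(M;O)`, i.e. the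
subalgebras of `𝒜(M) ⊗ ℬ(M)` generated by the `a ⊗ b` with `a ∈ 𝒜(M;O)`, `b ∈ ℬ(M;O)`. -/
abbrev QFT.tensor {X : GHSpacetime d M} (A B : QFT.{v, u} X) : QFT.{v, u} X where
  alg := A.alg ⊗[ℂ] B.alg
  loc O := StarAlgebra.adjoin ℂ {x | ∃ a ∈ A.loc O, ∃ b ∈ B.loc O, x = a ⊗ₜ[ℂ] b}
  loc_whole := by
    rw [eq_top_iff, A.loc_whole, B.loc_whole]
    rintro x -
    induction x using TensorProduct.induction_on with
    | zero => exact zero_mem _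
    | tmul a b => exact StarAlgebra.subset_adjoin _ _ ⟨a, trivial, b, trivial, rfl⟩
    | add x y hx hy => exact add_mem hx hy
  isotony O₁ O₂ h := by
    refine StarAlgebra.adjoin_mono ?_
    rintro _ ⟨a, ha, b, hb, rfl⟩
    exact ⟨a, A.isotony _ _ h ha, b, B.isotony _ _ h hb, rfl⟩
  einstein O₁ O₂ h := by
    refine commute_adjoin ?_ ?_
    · rintro _ ⟨a, ha, b, hb, rfl⟩
      exact ⟨star a, star_mem ha, star b, star_mem hb, by simp⟩
    · rintro _ ⟨a, ha, b, hb, rfl⟩ _ ⟨a', ha', b', hb', rfl⟩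
      simp [A.einstein _ _ h a ha a' ha', B.einstein _ _ h b hb b' hb']
  timeslice O₁ O₂ h hS := by rw [A.timeslice _ _ h hS, B.timeslice _ _ h hS]

/-- The tensor product `⨂ᵢ ℬᵢ` of a family of QFTs (used for finite families), with local algebras
`⨂ᵢ ℬᵢ(M;O)`. -/
abbrev QFT.piTensor {X : GHSpacetime d M} {ι : Type} (B : ι → QFT.{v, u} X) :
    QFT.{v, u} X where
  alg := ⨂[ℂ] i, (B i).alg
  loc O := StarAlgebra.adjoin ℂ
    {x | ∃ b : ∀ i, (B i).alg, (∀ i, b i ∈ (B i).loc O) ∧ x = PiTensorProduct.tprod ℂ b}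
  loc_whole := by
    rw [eq_top_iff]
    simp only [(B _).loc_whole]
    rintro x -
    induction x using PiTensorProduct.induction_on with
    | smul_tprod z f =>
      exact SMulMemClass.smul_mem z
        (StarAlgebra.subset_adjoin _ _ ⟨f, fun _ ↦ trivial, rfl⟩)
    | add x y hx hy => exact add_mem hx hy
  isotony O₁ O₂ h := by
    refine StarAlgebra.adjoin_mono ?_
    rintro _ ⟨b, hb, rfl⟩
    exact ⟨b, fun i ↦ (B i).isotony _ _ h (hb i), rfl⟩
  einstein O₁ O₂ h := by
    refine commute_adjoin ?_ ?_
    · rintro _ ⟨b, hb, rfl⟩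
      exact ⟨fun i ↦ star (b i), fun i ↦ star_mem (hb i), star_tprod b⟩
    · rintro _ ⟨b, hb, rfl⟩ _ ⟨b', hb', rfl⟩
      rw [PiTensorProduct.tprod_mul_tprod, PiTensorProduct.tprod_mul_tprod]
      congr 1
      funext i
      exact (B i).einstein _ _ h _ (hb i) _ (hb' i)
  timeslice O₁ O₂ h hS := by simp only [fun i ↦ (B i).timeslice _ _ h hS]

/-! ### Coupled combinations and scattering maps -/

/-- A coupled combination `𝒞` of the system `𝒜` and the probe `ℬ` with temporally compact
coupling zone `K`. -/
structure CoupledCombination {X : GHSpacetime d M} (A B : QFT.{v, u} X) (K : Set M) where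
  /-- The coupled theory `𝒞`. -/
  theory : QFT.{v, u} X
  temporallyCompact : TemporallyCompact X K
  /-- The identifications `ι_O : 𝒰(M;O) → 𝒞(M;O)` for regions `O ⊆ M \ ch(K)`. -/
  iso (O : Region X) (hO : O.carrier ⊆ (X.hull K)ᶜ) :
    (A.tensor B).loc O ≃⋆ₐ[ℂ] theory.loc O
  compat (O₁ O₂ : Region X) (h₁ : O₁.carrier ⊆ (X.hull K)ᶜ) (h₂ : O₂.carrier ⊆ (X.hull K)ᶜ)
    (h : O₁.carrier ⊆ O₂.carrier) (x : (A.tensor B).loc O₁) :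
    StarSubalgebra.inclusion (theory.isotony O₁ O₂ h) (iso O₁ h₁ x) =
      iso O₂ h₂ (StarSubalgebra.inclusion ((A.tensor B).isotony O₁ O₂ h) x)

/-- The identification of a subalgebra that equals the full algebra with the full algebra. -/
def ofEqTop {R : Type u} [Ring R] [Algebra ℂ R] [StarRing R] [StarModule ℂ R]
    (S : StarSubalgebra ℂ R) (hS : S = ⊤) : S ≃⋆ₐ[ℂ] R where
  toFun x := x
  invFun x := ⟨x, hS ▸ trivial⟩
  left_inv _ := rfl
  right_inv _ := rfl
  map_mul' _ _ := rfl
  map_add' _ _ := rfl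
  map_star' _ := rfl
  map_smul' _ _ := rfl

namespace CoupledCombination

variable {X : GHSpacetime d M} {A B : QFT.{v, u} X} {K : Set M}
  (C : CoupledCombination A B K)

/-- `τ⁺ : 𝒰(M) = 𝒰(M;M⁺) → 𝒞(M;M⁺) = 𝒞(M)`. -/
def tauPlus : (A.tensor B).alg ≃⋆ₐ[ℂ] C.theory.alg :=
  let hc := outRegion_cauchy X K C.temporallyCompact
  ((ofEqTop _ ((A.tensor B).loc_eq_top _ hc)).symm.trans
    (C.iso _ (outRegion_subset X K C.temporallyCompact))).trans
    (ofEqTop _ (C.theory.loc_eq_top _ hc))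

/-- `τ⁻ : 𝒰(M) = 𝒰(M;M⁻) → 𝒞(M;M⁻) = 𝒞(M)`. -/
def tauMinus : (A.tensor B).alg ≃⋆ₐ[ℂ] C.theory.alg :=
  let hc := inRegion_cauchy X K C.temporallyCompact
  ((ofEqTop _ ((A.tensor B).loc_eq_top _ hc)).symm.trans
    (C.iso _ (inRegion_subset X K C.temporallyCompact))).trans
    (ofEqTop _ (C.theory.loc_eq_top _ hc))

/-- The scattering map `Θ = (τ⁻)⁻¹ ∘ τ⁺` on `𝒜(M) ⊗ ℬ(M)`. -/
def scattering : (A.alg ⊗[ℂ] B.alg) ≃⋆ₐ[ℂ] (A.alg ⊗[ℂ] B.alg) :=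
  C.tauPlus.trans C.tauMinus.symm

/-- The scattering map as a linear map. -/
def scatteringLin : (A.alg ⊗[ℂ] B.alg) →ₗ[ℂ] (A.alg ⊗[ℂ] B.alg) where
  toFun x := C.scattering x
  map_add' x y := map_add C.scattering x y
  map_smul' z x := map_smul C.scattering z x

end CoupledCombination

/-! ### States, effects, pre-instruments and selective updates -/

/-- States on a unital `*`-algebra. -/
structure IsState {R : Type u} [Ring R] [Algebra ℂ R] [StarRing R]
    (φ : Module.Dual ℂ R) : Prop where
  map_one : φ 1 = 1
  nonneg : ∀ a, 0 ≤ φ (star a * a)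

/-- `x ≥ 0`, i.e. `x` is a finite sum of elements `a* a`. -/
def IsPositive {R : Type u} [Ring R] [StarRing R] (x : R) : Prop :=
  ∃ (k : ℕ) (a : Fin k → R), x = ∑ i, star (a i) * a i

/-- Effects. -/
def IsEffect {R : Type u} [Ring R] [StarRing R] (E : R) : Prop :=
  IsPositive E ∧ IsPositive (1 - E)

/-- The map `η_σ : 𝒜 ⊗ ℬ → 𝒜`, `a ⊗ b ↦ σ(b) a`. -/
def eta {R S : Type u} [Ring R] [Algebra ℂ R] [Ring S] [Algebra ℂ S] (σ : Module.Dual ℂ S) :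
    R ⊗[ℂ] S →ₗ[ℂ] R :=
  (TensorProduct.rid ℂ R).toLinearMap ∘ₗ σ.lTensor R

/-- The product functional `⨂ᵢ σᵢ` on `⨂ᵢ ℬᵢ`, with `(⨂ᵢ σᵢ)(⨂ᵢ bᵢ) = ∏ᵢ σᵢ(bᵢ)`. -/
def productFunctional {ι : Type} [Finite ι] {R : ι → Type u} [∀ i, Ring (R i)]
    [∀ i, Algebra ℂ (R i)] (σ : ∀ i, Module.Dual ℂ (R i)) : Module.Dual ℂ (⨂[ℂ] i, R i) :=
  PiTensorProduct.dualDistrib (PiTensorProduct.tprod ℂ σ)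

namespace CoupledCombination

variable {X : GHSpacetime d M} {A B : QFT.{v, u} X} {K : Set M}
  (C : CoupledCombination A B K)

/-- The induced observable `ε_σ(F) = η_σ(Θ(1 ⊗ F))`. -/
def induced (σ : Module.Dual ℂ B.alg) (F : B.alg) : A.alg :=
  eta σ (C.scattering (1 ⊗ₜ[ℂ] F))

/-- The pre-instrument `𝓘_σ(F)(φ)(a) = φ(η_σ(Θ(a ⊗ F)))`. -/
def preInstrument (σ : Module.Dual ℂ B.alg) (F : B.alg) (φ : Module.Dual ℂ A.alg) :
    Module.Dual ℂ A.alg :=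
  φ ∘ₗ eta σ ∘ₗ C.scatteringLin ∘ₗ (TensorProduct.mk ℂ A.alg B.alg).flip F

/-- The success probability `P_σ(F; φ) = φ(ε_σ(F))` of the test `F` of the probe. -/
def prob (σ : Module.Dual ℂ B.alg) (F : B.alg) (φ : Module.Dual ℂ A.alg) : ℂ :=
  φ (C.induced σ F)

/-- The selective update `φ' = 𝓘_σ(F)(φ) / 𝓘_σ(F)(φ)(1)` after a successful test of `F`. -/
def update (σ : Module.Dual ℂ B.alg) (F : B.alg) (φ : Module.Dual ℂ A.alg) :
    Module.Dual ℂ A.alg :=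
  (C.preInstrument σ F φ 1)⁻¹ • C.preInstrument σ F φ

end CoupledCombination

/-- `φ⁽⁰⁾ = φ` and `φ⁽ʳ⁺¹⁾` is obtained from `φ⁽ʳ⁾` by the `r`-th update (counted from `0`). -/
def iterateUpdates {V : Type u} {n : ℕ} (upd : Fin n → V → V) (φ : V) : ℕ → V
  | 0 => φ
  | r + 1 => if h : r < n then upd ⟨r, h⟩ (iterateUpdates upd φ r) else iterateUpdates upd φ r

/-! ### Causal factorisation -/

/-- Causal factorisation: `Θ = (Θ₁ ⊗ id) ∘ (Θ₂ ⊗₂ id)` as maps of `𝒜 ⊗ (ℬ₁ ⊗ ℬ₂) = (𝒜 ⊗ ℬ₁) ⊗ ℬ₂`, where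
`Θ₂ ⊗₂ id` acts on the first and third factors. -/
def CausallyFactorises {R S₁ S₂ : Type u} [Ring R] [Algebra ℂ R] [Ring S₁] [Algebra ℂ S₁] [Ring S₂]
    [Algebra ℂ S₂] (Θ₁ : R ⊗[ℂ] S₁ →ₗ[ℂ] R ⊗[ℂ] S₁) (Θ₂ : R ⊗[ℂ] S₂ →ₗ[ℂ] R ⊗[ℂ] S₂)
    (Θ : R ⊗[ℂ] (S₁ ⊗[ℂ] S₂) →ₗ[ℂ] R ⊗[ℂ] (S₁ ⊗[ℂ] S₂)) : Prop :=
  (TensorProduct.assoc ℂ R S₁ S₂).symm.conj Θ =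
    Θ₁.rTensor S₂ ∘ₗ (TensorProduct.rightComm ℂ R S₂ S₁).conj (Θ₂.rTensor S₁)

section Join

variable {n : ℕ} (R : Fin n → Type u) [∀ i, Ring (R i)] [∀ i, Algebra ℂ (R i)]

/-- `S ∪ {j}` as a disjoint union. -/
def insertEquiv (S : Finset (Fin n)) (j : Fin n) (hj : j ∉ S) :
    ↥(insert j S) ≃ ↥S ⊕ Unit where
  toFun i := if h : i.1 = j then .inr () else .inl ⟨i.1, Finset.mem_of_mem_insert_of_ne i.2 h⟩
  invFun := Sum.elim (fun i ↦ ⟨i.1, Finset.mem_insert_of_mem i.2⟩)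
    (fun _ ↦ ⟨j, Finset.mem_insert_self j S⟩)
  left_inv i := by
    by_cases h : i.1 = j
    · simp [h, Subtype.ext_iff]
    · simp [h]
  right_inv x := by
    rcases x with i | _
    · have : i.1 ≠ j := fun h ↦ hj (h ▸ i.2)
      simp [this]
    · simp

/-- The canonical identification `(⨂_{i ∈ S} Rᵢ) ⊗ Rⱼ ≃ ⨂_{i ∈ S ∪ {j}} Rᵢ` for `j ∉ S`. -/
def join (S : Finset (Fin n)) (j : Fin n) (hj : j ∉ S) :
    (⨂[ℂ] i : ↥S, R i) ⊗[ℂ] R j ≃ₗ[ℂ] ⨂[ℂ] i : ↥(insert j S), R i :=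
  (TensorProduct.congr (LinearEquiv.refl ℂ _)
    (PiTensorProduct.subsingletonEquiv (R := ℂ) (s := fun _ : Unit ↦ R j) ()).symm).trans
    ((PiTensorProduct.tmulEquivDep ℂ
      (fun x : ↥S ⊕ Unit ↦ R ((insertEquiv S j hj).symm x))).trans
      (PiTensorProduct.reindex ℂ (fun i : ↥(insert j S) ↦ R i) (insertEquiv S j hj)).symm)

theorem join_tmul (S : Finset (Fin n)) (j : Fin n) (hj : j ∉ S) (b : ∀ i, R i) :
    join R S j hj ((PiTensorProduct.tprod ℂ fun i : ↥S ↦ b i) ⊗ₜ[ℂ] b j) =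
      PiTensorProduct.tprod ℂ fun i : ↥(insert j S) ↦ b i := by
  have h1 : (PiTensorProduct.subsingletonEquiv (R := ℂ) (s := fun _ : Unit ↦ R j) ()).symm (b j) =
      PiTensorProduct.tprod ℂ fun _ : Unit ↦ b j := by
    rw [LinearEquiv.symm_apply_eq, PiTensorProduct.subsingletonEquiv_apply_tprod]
  have h2 := PiTensorProduct.tmulEquivDep_apply ℂ
    (fun x : ↥S ⊕ Unit ↦ R ((insertEquiv S j hj).symm x))
    (fun i : ↥S ↦ b i) (fun _ : Unit ↦ b j)
  refine (LinearEquiv.symm_apply_eq (PiTensorProduct.reindex ℂ (fun i : ↥(insert j S) ↦ R i)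
    (insertEquiv S j hj))).2 ?_
  refine Eq.trans ?_ (PiTensorProduct.reindex_tprod (R := ℂ)
    (s := fun i : ↥(insert j S) ↦ R i) (insertEquiv S j hj) (fun i : ↥(insert j S) ↦ b i)).symm
  refine Eq.trans (congrArg (fun y ↦ PiTensorProduct.tmulEquivDep ℂ
    (fun x : ↥S ⊕ Unit ↦ R ((insertEquiv S j hj).symm x))
    ((PiTensorProduct.tprod ℂ fun i : ↥S ↦ b i) ⊗ₜ[ℂ] y)) h1) (h2.trans ?_)
  congr 1
  funext x
  rcases x with i | _ <;> rfl

end Join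

end QFT

end MeasurementQFT

end

namespace MeasurementQFT

universe v u

/-! ### Positive functionals -/

/-! The argument works with unnormalised functionals. Let `ψ r` be the functional on the system
obtained by testing the first `r` probes of the causal order jointly, using their merged coupling
and the product of their preparation states. Then `ψ 0 = φ`, and `ψ n 1` is the joint probability.

Causal factorisation, evaluated in a product functional, says that adding the next probe applies its
own pre-instrument: `ψ (r + 1)` is the pre-instrument of test `r` at `ψ r`
(`mergedPreInstrument_insert`). As pre-instruments are linear in the functional, normalising at
every step only splits off scalars, so `ψ r` is the product of the first `r` single-test
probabilities times the `r`-th update (`iterate_eq_prod_smul`). Evaluation at `1` for `r = n` gives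
the product formula, and its left side does not involve the order.

Positivity enters twice. Updates are states because a product of positive functionals is positive on
the algebraic tensor product, by the Schur product theorem for Gram matrices
(`nonneg_eta_star_mul_self`). If a probability vanishes, the whole pre-instrument vanishes
(`eq_zero_of_map_one_eq_zero`), so the formula survives division by zero. -/

@[simp] theorem eta_tmul {R S : Type u} [Ring R] [Algebra ℂ R] [Ring S] [Algebra ℂ S]
    (σ : Module.Dual ℂ S) (a : R) (b : S) : eta σ (a ⊗ₜ[ℂ] b) = σ b • a := by
  simp [eta]

section Positive

variable {R S : Type u} [Ring R] [Algebra ℂ R] [StarRing R] [StarModule ℂ R]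
  [Ring S] [Algebra ℂ S] [StarRing S] [StarModule ℂ S]

/-- Polarisation: positivity at `a + b` forces opposite imaginary parts, and positivity at `a + i b`
forces equal real parts. -/
theorem map_star_mul_eq_conj {φ : Module.Dual ℂ R} (hφ : ∀ a, 0 ≤ φ (star a * a)) (a b : R) :
    φ (star a * b) = star (φ (star b * a)) := by
  have ha := (Complex.nonneg_iff.1 (hφ a)).2
  have hb := (Complex.nonneg_iff.1 (hφ b)).2
  have h1 := (Complex.nonneg_iff.1 (hφ (a + b))).2
  have h2 := (Complex.nonneg_iff.1 (hφ (a + Complex.I • b))).2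
  simp only [star_add, star_smul, add_mul, mul_add, smul_mul_assoc, mul_smul_comm, map_add,
    map_smul, smul_eq_mul, Complex.star_def, Complex.conj_I, Complex.add_im, Complex.mul_im,
    Complex.mul_re, Complex.neg_im, Complex.neg_re, Complex.I_im, Complex.I_re] at h1 h2
  apply Complex.ext
  · simp only [Complex.star_def, Complex.conj_re]
    linarith
  · simp only [Complex.star_def, Complex.conj_im]
    linarith

theorem posSemidef_gram {φ : Module.Dual ℂ R} (hφ : ∀ a, 0 ≤ φ (star a * a)) {ι : Type*}
    [Fintype ι] (a : ι → R) : (Matrix.of fun i j ↦ φ (star (a i) * a j)).PosSemidef := by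
  refine Matrix.PosSemidef.of_dotProduct_mulVec_nonneg ?_ fun x ↦ ?_
  · ext i j
    exact (map_star_mul_eq_conj hφ (a i) (a j)).symm
  -- The quadratic form of the Gram matrix at `x` is `φ (star y * y)` with `y = ∑ i, x i • a i`.
  · have h := hφ (∑ i, x i • a i)
    simp only [star_sum, star_smul, Finset.sum_mul, Finset.mul_sum, map_sum, smul_mul_assoc,
      mul_smul_comm, map_smul, smul_eq_mul] at h
    simp only [dotProduct, Matrix.mulVec, Finset.mul_sum, Pi.star_apply, Matrix.of_apply]
    rw [Finset.sum_comm]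
    convert h using 3 with i hi j hj
    ring

/-- A positive functional that vanishes at `1` is zero. -/
theorem eq_zero_of_map_one_eq_zero {φ : Module.Dual ℂ R} (hφ : ∀ a, 0 ≤ φ (star a * a))
    (h1 : φ 1 = 0) : φ = 0 := by
  ext a
  have hq := hφ a
  obtain ⟨q, hq0, hqe⟩ : ∃ q : ℝ, 0 ≤ q ∧ φ (star a * a) = q :=
    ⟨_, (Complex.nonneg_iff.1 hq).1, Complex.ext rfl (Complex.nonneg_iff.1 hq).2.symm⟩
  have hs : φ (star a) = star (φ a) := by simpa using map_star_mul_eq_conj hφ a 1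
  -- For `y = 1 - t * star (φ a) • a` the value `φ (star y * y)` is `(t² q - 2 t) |φ a|²`. With `t =
  -- 1 / (q + 1)` one has `t q = 1 - t`, so the coefficient is negative and `φ a` must vanish. The
  -- `+ 1` covers `q = 0`.
  set t : ℝ := (q + 1)⁻¹ with ht
  have hp := (Complex.nonneg_iff.1 (hφ (1 + (-(t : ℂ) * star (φ a)) • a))).1
  simp only [star_add, star_smul, add_mul, mul_add, smul_mul_assoc, mul_smul_comm, map_add,
    map_smul, smul_eq_mul, star_one, one_mul, mul_one, h1, hs, hqe, Complex.star_def] at hp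
  simp at hp
  have htq : t * (q + 1) = 1 := inv_mul_cancel₀ (by positivity)
  have ht0 : 0 < t := by positivity
  have hN : t * ((φ a).re ^ 2 + (φ a).im ^ 2) ≤ 0 := by
    have : t * q = 1 - t := by linarith
    nlinarith [mul_nonneg ht0.le (add_nonneg (sq_nonneg (φ a).re) (sq_nonneg (φ a).im)),
      mul_nonneg (mul_nonneg ht0.le ht0.le)
        (add_nonneg (sq_nonneg (φ a).re) (sq_nonneg (φ a).im))]
  have hN' : (φ a).re ^ 2 + (φ a).im ^ 2 ≤ 0 := by
    by_contra hc
    exact absurd hN (not_le.2 (mul_pos ht0 (not_le.1 hc)))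
  apply Complex.ext
  · simpa using pow_eq_zero_iff two_ne_zero |>.1
      (le_antisymm (by nlinarith [sq_nonneg (φ a).im]) (sq_nonneg (φ a).re))
  · simpa using pow_eq_zero_iff two_ne_zero |>.1
      (le_antisymm (by nlinarith [sq_nonneg (φ a).re]) (sq_nonneg (φ a).im))

/-- The product of two positive functionals is positive. -/
theorem nonneg_eta_star_mul_self {φ : Module.Dual ℂ R} (hφ : ∀ a, 0 ≤ φ (star a * a))
    {σ : Module.Dual ℂ S} (hσ : ∀ a, 0 ≤ σ (star a * a)) (x : R ⊗[ℂ] S) :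
    0 ≤ φ (eta σ (star x * x)) := by
  obtain ⟨s, rfl⟩ := TensorProduct.exists_finset x
  rw [← Finset.sum_coe_sort]
  -- For `x = ∑ rᵢ ⊗ sᵢ` the claimed value is the sum of all entries of the Hadamard product of the
  -- two Gram matrices, that is, its quadratic form at the all-ones vector.
  have h := ((posSemidef_gram hφ fun i : ↥s ↦ i.1.1).hadamard
    (posSemidef_gram hσ fun i : ↥s ↦ i.1.2)).dotProduct_mulVec_nonneg
    (fun _ ↦ 1)
  simp only [dotProduct, Matrix.mulVec, Matrix.hadamard_apply, Matrix.of_apply, Pi.star_apply,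
    star_one, one_mul, mul_one] at h
  rw [star_sum, Finset.sum_mul]
  simp only [Finset.mul_sum, map_sum, TensorProduct.star_tmul,
    Algebra.TensorProduct.tmul_mul_tmul, eta_tmul, map_smul, smul_eq_mul]
  simpa only [mul_comm] using h

end Positive

/-! ### Pre-instruments and updates -/

section Update

variable {d : ℕ} {M : Type v} [TopologicalSpace M]
  [ChartedSpace (EuclideanSpace ℝ (Fin d)) M] [IsManifold (𝓡 d) ∞ M]
  {X : GHSpacetime d M} {A B : QFT.{v, u} X} {K : Set M} (C : CoupledCombination A B K)

namespace CoupledCombination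

theorem preInstrument_apply (σ : Module.Dual ℂ B.alg) (F : B.alg) (φ : Module.Dual ℂ A.alg)
    (a : A.alg) : C.preInstrument σ F φ a = φ (eta σ (C.scattering (a ⊗ₜ[ℂ] F))) :=
  rfl

theorem preInstrument_one (σ : Module.Dual ℂ B.alg) (F : B.alg) (φ : Module.Dual ℂ A.alg) :
    C.preInstrument σ F φ 1 = C.prob σ F φ :=
  rfl

theorem preInstrument_smul (σ : Module.Dual ℂ B.alg) (F : B.alg) (c : ℂ)
    (φ : Module.Dual ℂ A.alg) : C.preInstrument σ F (c • φ) = c • C.preInstrument σ F φ :=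
  rfl

theorem preInstrument_nonneg {σ : Module.Dual ℂ B.alg} (hσ : ∀ b, 0 ≤ σ (star b * b)) {F : B.alg}
    (hF : IsPositive F) {φ : Module.Dual ℂ A.alg} (hφ : ∀ a, 0 ≤ φ (star a * a)) (a : A.alg) :
    0 ≤ C.preInstrument σ F φ (star a * a) := by
  obtain ⟨k, z, rfl⟩ := hF
  rw [preInstrument_apply, TensorProduct.tmul_sum, map_sum, map_sum, map_sum]
  refine Finset.sum_nonneg fun i _ ↦ ?_
  have h : (star a * a) ⊗ₜ[ℂ] (star (z i) * z i) = star (a ⊗ₜ[ℂ] z i) * (a ⊗ₜ[ℂ] z i) := by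
    simp
  rw [h, map_mul, map_star]
  exact nonneg_eta_star_mul_self hφ hσ _

theorem isState_update {σ : Module.Dual ℂ B.alg} (hσ : ∀ b, 0 ≤ σ (star b * b)) {F : B.alg}
    (hF : IsPositive F) {φ : Module.Dual ℂ A.alg} (hφ : ∀ a, 0 ≤ φ (star a * a))
    (h : C.prob σ F φ ≠ 0) : IsState (C.update σ F φ) where
  map_one := by
    rw [← preInstrument_one] at h
    simp [update, h]
  nonneg a := by
    have h1 : 0 ≤ C.preInstrument σ F φ 1 := by
      simpa using C.preInstrument_nonneg hσ hF hφ 1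
    exact mul_nonneg (inv_nonneg.2 h1) (C.preInstrument_nonneg hσ hF hφ a)

/-- The pre-instrument is the success probability times the update, even if the former vanishes. -/
theorem preInstrument_eq_prob_smul_update {σ : Module.Dual ℂ B.alg}
    (hσ : ∀ b, 0 ≤ σ (star b * b)) {F : B.alg} (hF : IsPositive F) {φ : Module.Dual ℂ A.alg}
    (hφ : ∀ a, 0 ≤ φ (star a * a)) :
    C.preInstrument σ F φ = C.prob σ F φ • C.update σ F φ := by
  rw [update, preInstrument_one]
  by_cases h : C.prob σ F φ = 0
  · rw [h, zero_smul]
    exact eq_zero_of_map_one_eq_zero (C.preInstrument_nonneg hσ hF hφ) h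
  · rw [smul_inv_smul₀ h]

theorem coe_iso_mono {O₁ O₂ : Region X} (h₁ : O₁.carrier ⊆ (X.hull K)ᶜ)
    (h₂ : O₂.carrier ⊆ (X.hull K)ᶜ) (h : O₁.carrier ⊆ O₂.carrier) {x : (A.tensor B).alg}
    (hx₁ : x ∈ (A.tensor B).loc O₁) (hx₂ : x ∈ (A.tensor B).loc O₂) :
    (C.iso O₁ h₁ ⟨x, hx₁⟩ : C.theory.alg) = C.iso O₂ h₂ ⟨x, hx₂⟩ :=
  congrArg Subtype.val (C.compat O₁ O₂ h₁ h₂ h ⟨x, hx₁⟩)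

theorem tauPlus_apply (x : (A.tensor B).alg)
    (hx : x ∈ (A.tensor B).loc (outRegion X K C.temporallyCompact)) :
    C.tauPlus x = C.iso _ (outRegion_subset X K C.temporallyCompact) ⟨x, hx⟩ :=
  rfl

theorem tauMinus_apply (x : (A.tensor B).alg)
    (hx : x ∈ (A.tensor B).loc (inRegion X K C.temporallyCompact)) :
    C.tauMinus x = C.iso _ (inRegion_subset X K C.temporallyCompact) ⟨x, hx⟩ :=
  rfl

theorem scattering_apply (x : A.alg ⊗[ℂ] B.alg) :
    C.scattering x = C.tauMinus.symm (C.tauPlus x) :=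
  rfl

/-- The scattering map of a trivial coupling is the identity. -/
theorem scattering_eq_self_of_eq_empty (hK : K = ∅) (x : A.alg ⊗[ℂ] B.alg) :
    C.scattering x = x := by
  have hw : (Region.whole X).carrier ⊆ (X.hull K)ᶜ := by
    rintro p - ⟨⟨q, hq, -⟩, -⟩
    exact (hK ▸ hq : q ∈ (∅ : Set M))
  have hmem (O : Region X) (hO : ∃ S, X.IsCauchySurface S ∧ S ⊆ O.carrier) :
      x ∈ (A.tensor B).loc O := by
    rw [(A.tensor B).loc_eq_top O hO]
    trivial
  have h₀ : x ∈ (A.tensor B).loc (Region.whole X) := by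
    rw [(A.tensor B).loc_whole]
    trivial
  -- The hull of `∅` is empty, so `M` itself is an admissible region. By compatibility, `τ⁺` and
  -- `τ⁻` then both agree with the single isomorphism `ι_M`.
  have h : C.tauPlus x = C.tauMinus x := by
    rw [C.tauPlus_apply x (hmem _ (outRegion_cauchy X K C.temporallyCompact)),
      C.tauMinus_apply x (hmem _ (inRegion_cauchy X K C.temporallyCompact))]
    exact (C.coe_iso_mono _ hw (Set.subset_univ _) _ h₀).trans
      (C.coe_iso_mono _ hw (Set.subset_univ _) _ h₀).symm
  rw [scattering_apply, h, StarAlgEquiv.symm_apply_apply]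

end CoupledCombination

/-- An iteration of tests: the unnormalised functionals `ψ r` obtained with the pre-instruments
are the product of the success probabilities times the successive updates. -/
theorem iterate_eq_prod_smul {n : ℕ} {B : Fin n → QFT.{v, u} X} {K : Fin n → Set M}
    (C : ∀ j, CoupledCombination A (B j) (K j)) {φ : Module.Dual ℂ A.alg} (hφ : IsState φ)
    {σ : ∀ j, Module.Dual ℂ (B j).alg} (hσ : ∀ j, IsState (σ j)) {E : ∀ j, (B j).alg}
    (hE : ∀ j, IsEffect (E j)) (upd : ℕ → Module.Dual ℂ A.alg)
    (hupd : upd = iterateUpdates (fun k ↦ (C k).update (σ k) (E k)) φ)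
    (ψ : ℕ → Module.Dual ℂ A.alg) (h0 : ψ 0 = φ)
    (hs : ∀ r : Fin n, ψ (r + 1) = (C r).preInstrument (σ r) (E r) (ψ r)) (r : ℕ) (hr : r ≤ n) :
    ((∀ s : Fin n, s.1 < r → (C s).prob (σ s) (E s) (upd s) ≠ 0) → IsState (upd r)) ∧
      ψ r = (∏ s : Fin n with s.1 < r, (C s).prob (σ s) (E s) (upd s)) • upd r := by
  -- Both claims are proved together: splitting off the next probability requires `upd r` to be
  -- positive.
  induction r with
  | zero => exact ⟨fun _ ↦ by simpa [hupd, iterateUpdates] using hφ,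
      by simp [hupd, iterateUpdates, h0]⟩
  | succ r ih =>
    obtain ⟨ih1, ih2⟩ := ih (by omega)
    set j : Fin n := ⟨r, by omega⟩ with hj
    have hu : upd (r + 1) = (C j).update (σ j) (E j) (upd r) := by
      simp only [hupd, iterateUpdates]
      exact dif_pos j.2
    constructor
    · intro h
      rw [hu]
      exact (C j).isState_update (hσ j).nonneg (hE j).1
        (ih1 fun s hs ↦ h s (by omega)).nonneg (h j (by simp [hj]))
    · have hf : (Finset.univ.filter fun s : Fin n ↦ s.1 < r + 1) =
          insert j (Finset.univ.filter fun s : Fin n ↦ s.1 < r) := by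
        ext s
        simp only [hj, Finset.mem_filter, Finset.mem_univ, true_and, Finset.mem_insert, Fin.ext_iff]
        omega
      rw [hf, Finset.prod_insert (by simp [hj]), hu, show ψ (r + 1) = _ from hs j]
      change (C j).preInstrument (σ j) (E j) (ψ r) = _
      rw [ih2, CoupledCombination.preInstrument_smul]
      -- If an earlier probability is zero, `upd r` need not be a state, but the scalar product
      -- already contains that zero and both sides vanish.
      by_cases hc : ∀ s : Fin n, s.1 < r → (C s).prob (σ s) (E s) (upd s) ≠ 0
      · rw [(C j).preInstrument_eq_prob_smul_update (hσ j).nonneg (hE j).1 (ih1 hc).nonneg,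
          smul_smul, mul_comm]
      · push Not at hc
        obtain ⟨s, hs1, hs2⟩ := hc
        rw [Finset.prod_eq_zero (i := s) (by simpa using hs1) hs2]
        simp

end Update

/-! ### Composition of pre-instruments -/

section Factorise

variable {R S₁ S₂ : Type u} [Ring R] [Algebra ℂ R] [Ring S₁] [Algebra ℂ S₁] [Ring S₂]
    [Algebra ℂ S₂]

theorem eta_rTensor (σ : Module.Dual ℂ S₂) (Θ : R →ₗ[ℂ] R) (x : R ⊗[ℂ] S₂) :
    eta σ (Θ.rTensor S₂ x) = Θ (eta σ x) := by
  induction x using TensorProduct.induction_on with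
  | zero => simp
  | tmul a b => simp [eta]
  | add x y hx hy => simp only [map_add, hx, hy]

theorem eta_rightComm_tmul (σ : Module.Dual ℂ S₂) (x : R ⊗[ℂ] S₂) (b : S₁) :
    eta σ (TensorProduct.rightComm ℂ R S₂ S₁ (x ⊗ₜ[ℂ] b)) = eta σ x ⊗ₜ[ℂ] b := by
  induction x using TensorProduct.induction_on with
  | zero => simp
  | tmul a c => simp [eta, TensorProduct.smul_tmul']
  | add x y hx hy => simp only [map_add, TensorProduct.add_tmul, hx, hy]

theorem eta_dualDistrib (σ₁ : Module.Dual ℂ S₁) (σ₂ : Module.Dual ℂ S₂)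
    (x : R ⊗[ℂ] (S₁ ⊗[ℂ] S₂)) :
    eta (TensorProduct.dualDistrib ℂ S₁ S₂ (σ₁ ⊗ₜ[ℂ] σ₂)) x =
      eta σ₁ (eta σ₂ ((TensorProduct.assoc ℂ R S₁ S₂).symm x)) := by
  induction x using TensorProduct.induction_on with
  | zero => simp
  | tmul a y =>
    induction y using TensorProduct.induction_on with
    | zero => simp
    | tmul b c => simp [eta, smul_smul, mul_comm]
    | add x y hx hy => simp only [map_add, TensorProduct.tmul_add, hx, hy]
  | add x y hx hy => simp only [map_add, hx, hy]

/-- Since `Θ₂` acts first on observables, the second probe can be integrated out before `Θ₁` is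
applied. Dually, on functionals, the pre-instrument of probe 1 comes before that of probe 2. -/
theorem CausallyFactorises.eta_apply {Θ₁ : R ⊗[ℂ] S₁ →ₗ[ℂ] R ⊗[ℂ] S₁}
    {Θ₂ : R ⊗[ℂ] S₂ →ₗ[ℂ] R ⊗[ℂ] S₂} {Θ : R ⊗[ℂ] (S₁ ⊗[ℂ] S₂) →ₗ[ℂ] R ⊗[ℂ] (S₁ ⊗[ℂ] S₂)}
    (h : CausallyFactorises Θ₁ Θ₂ Θ) (σ₁ : Module.Dual ℂ S₁) (σ₂ : Module.Dual ℂ S₂)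
    (a : R) (b₁ : S₁) (b₂ : S₂) :
    eta (TensorProduct.dualDistrib ℂ S₁ S₂ (σ₁ ⊗ₜ[ℂ] σ₂)) (Θ (a ⊗ₜ[ℂ] (b₁ ⊗ₜ[ℂ] b₂))) =
      eta σ₁ (Θ₁ (eta σ₂ (Θ₂ (a ⊗ₜ[ℂ] b₂)) ⊗ₜ[ℂ] b₁)) := by
  have h' := LinearMap.congr_fun h ((a ⊗ₜ[ℂ] b₁) ⊗ₜ[ℂ] b₂)
  simp only [LinearEquiv.conj_apply_apply, LinearEquiv.symm_symm, TensorProduct.assoc_tmul,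
    LinearMap.comp_apply, TensorProduct.rightComm_symm, TensorProduct.rightComm_tmul,
    LinearMap.rTensor_tmul] at h'
  rw [eta_dualDistrib, h', eta_rTensor, eta_rightComm_tmul]

end Factorise

/-! ### Product functionals under adjoining one tensor factor. -/

section Join

variable {n : ℕ} (R : Fin n → Type u) [∀ i, Ring (R i)] [∀ i, Algebra ℂ (R i)]

theorem productFunctional_join (σ : ∀ j, Module.Dual ℂ (R j)) (S : Finset (Fin n)) (j : Fin n)
    (hj : j ∉ S) (x : (⨂[ℂ] i : ↥S, R i) ⊗[ℂ] R j) :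
    productFunctional (fun i : ↥(insert j S) ↦ σ i) (join R S j hj x) =
      TensorProduct.dualDistrib ℂ _ _ (productFunctional (fun i : ↥S ↦ σ i) ⊗ₜ[ℂ] σ j) x := by
  suffices h : productFunctional (fun i : ↥(insert j S) ↦ σ i) ∘ₗ (join R S j hj).toLinearMap =
      TensorProduct.dualDistrib ℂ _ _ (productFunctional (fun i : ↥S ↦ σ i) ⊗ₜ[ℂ] σ j) from
    LinearMap.congr_fun h x
  refine TensorProduct.ext (PiTensorProduct.ext (MultilinearMap.ext fun f ↦ LinearMap.ext
    fun c ↦ ?_))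
  -- `join_tmul` expects one family over all of `Fin n`, so `f` and `c` are glued; the value `0`
  -- outside `S ∪ {j}` is never used.
  let b (i : Fin n) : R i :=
    if h : i ∈ S then f ⟨i, h⟩ else if h : j = i then h ▸ c else 0
  have hf : f = fun i : ↥S ↦ b i := by
    funext i
    simp [b]
  have hc : c = b j := by simp [b, hj]
  rw [hf, hc]
  change productFunctional (fun i : ↥(insert j S) ↦ σ i)
      (join R S j hj ((PiTensorProduct.tprod ℂ fun i : ↥S ↦ b i) ⊗ₜ[ℂ] b j)) =
    productFunctional (fun i : ↥S ↦ σ i) (PiTensorProduct.tprod ℂ fun i : ↥S ↦ b i) * σ j (b j)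
  rw [join_tmul, productFunctional, productFunctional, PiTensorProduct.dualDistrib_apply,
    PiTensorProduct.dualDistrib_apply, Finset.prod_coe_sort _ fun i ↦ σ i (b i),
    Finset.prod_coe_sort _ fun i ↦ σ i (b i), Finset.prod_insert hj, mul_comm]

end Join

/-! ### Merged couplings: no probes, and one more probe. -/

section Merged

variable {d : ℕ} {M : Type v} [TopologicalSpace M]
  [ChartedSpace (EuclideanSpace ℝ (Fin d)) M] [IsManifold (𝓡 d) ∞ M]
  {X : GHSpacetime d M} {n : ℕ} {A : QFT.{v, u} X} {B : Fin n → QFT.{v, u} X} {K : Fin n → Set M}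
  (D : ∀ S : Finset (Fin n), CoupledCombination A (QFT.piTensor fun i : ↥S ↦ B i) (⋃ i ∈ S, K i))
  (σ : ∀ j, Module.Dual ℂ (B j).alg) (E : ∀ j, (B j).alg) (φ : Module.Dual ℂ A.alg)

/-- The functional after a successful joint test of the `Eᵢ`, `i ∈ S`, with the merged coupling,
before normalisation. -/
noncomputable def mergedPreInstrument (S : Finset (Fin n)) : Module.Dual ℂ A.alg :=
  (D S).preInstrument (productFunctional fun i : ↥S ↦ σ i)
    (PiTensorProduct.tprod ℂ fun i : ↥S ↦ E i) φ

/-- The coupling zone is an empty union, so the scattering map is trivial, and the empty product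
functional takes the value `1` on the empty tensor. -/
theorem mergedPreInstrument_empty : mergedPreInstrument D σ E φ ∅ = φ := by
  ext a
  rw [mergedPreInstrument, CoupledCombination.preInstrument_apply,
    CoupledCombination.scattering_eq_self_of_eq_empty _ (by simp)]
  simp [eta, productFunctional, PiTensorProduct.dualDistrib_apply]

/-- This is the inductive step: `CausallyFactorises.eta_apply` read through `φ`, after identifying
the probe algebra over `insert j S` with a binary tensor product by `join`. -/
theorem mergedPreInstrument_insert {S : Finset (Fin n)} {j : Fin n} (hj : j ∉ S)
    (Cj : CoupledCombination A (B j) (K j))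
    (h : CausallyFactorises (D S).scatteringLin Cj.scatteringLin
      (((join (fun i ↦ (B i).alg) S j hj).symm.lTensor A.alg).conj
        (D (insert j S)).scatteringLin)) :
    mergedPreInstrument D σ E φ (insert j S) =
      Cj.preInstrument (σ j) (E j) (mergedPreInstrument D σ E φ S) := by
  ext a
  have hη (x : A.alg ⊗[ℂ] (⨂[ℂ] i : ↥(insert j S), (B i).alg)) :
      eta (productFunctional fun i : ↥(insert j S) ↦ σ i) x =
        eta (TensorProduct.dualDistrib ℂ _ _ (productFunctional (fun i : ↥S ↦ σ i) ⊗ₜ[ℂ] σ j))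
          ((join (fun i ↦ (B i).alg) S j hj).symm.lTensor A.alg x) := by
    induction x using TensorProduct.induction_on with
    | zero => simp
    | tmul a y =>
      obtain ⟨y, rfl⟩ := (join (fun i ↦ (B i).alg) S j hj).surjective y
      rw [LinearEquiv.lTensor_tmul, LinearEquiv.symm_apply_apply, eta_tmul, eta_tmul,
        productFunctional_join]
    | add x y hx hy => simp only [map_add, hx, hy]
  have h' := h.eta_apply (productFunctional fun i : ↥S ↦ σ i) (σ j) a
    (PiTensorProduct.tprod ℂ fun i : ↥S ↦ E i) (E j)
  rw [LinearEquiv.conj_apply_apply, ← hη, LinearEquiv.symm_lTensor, LinearEquiv.symm_symm,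
    LinearEquiv.lTensor_tmul, join_tmul (fun i ↦ (B i).alg) S j hj E] at h'
  exact congrArg φ h'

end Merged

end MeasurementQFT

/-! ### Telescoping along a compatible causal order. -/

theorem mainTheorem3 {d : ℕ} {M : Type*} [TopologicalSpace M] [T2Space M]
    [SecondCountableTopology M] [ChartedSpace (EuclideanSpace ℝ (Fin d)) M]
    [IsManifold (𝓡 d) ∞ M] (X : MeasurementQFT.GHSpacetime d M) {n : ℕ}
    -- the system, the probes, the coupling zones
    (A : MeasurementQFT.QFT X) (B : Fin n → MeasurementQFT.QFT X) (K : Fin n → Set M)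
    -- the couplings of the system to the individual probes
    (C : ∀ j, MeasurementQFT.CoupledCombination A (B j) (K j))
    -- the merged couplings of the system to the combined probes
    (D : ∀ S : Finset (Fin n), MeasurementQFT.CoupledCombination A
      (MeasurementQFT.QFT.piTensor fun i : ↥S ↦ B i) (⋃ i ∈ S, K i))
    -- causal factorisation
    (hCF : ∀ (S : Finset (Fin n)) (j : Fin n) (hj : j ∉ S),
      MeasurementQFT.Precedes X (⋃ i ∈ S, K i) (K j) →
      MeasurementQFT.CausallyFactorises (D S).scatteringLin (C j).scatteringLin
        (((MeasurementQFT.join (fun i ↦ (B i).alg) S j hj).symm.lTensor A.alg).conj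
          (D (insert j S)).scatteringLin))
    -- the preparation states and the tests
    (φ : Module.Dual ℂ A.alg) (hφ : MeasurementQFT.IsState φ)
    (σ : ∀ j, Module.Dual ℂ (B j).alg) (hσ : ∀ j, MeasurementQFT.IsState (σ j))
    (E : ∀ j, (B j).alg) (hE : ∀ j, MeasurementQFT.IsEffect (E j)) :
    let joint : ℂ := (D Finset.univ).prob
      (MeasurementQFT.productFunctional fun i : ↥(Finset.univ : Finset (Fin n)) ↦ σ i)
      (PiTensorProduct.tprod ℂ fun i : ↥(Finset.univ : Finset (Fin n)) ↦ E i) φ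
    let updated (e : Equiv.Perm (Fin n)) (r : ℕ) : Module.Dual ℂ A.alg :=
      MeasurementQFT.iterateUpdates
        (fun k : Fin n ↦ (C (e k)).update (σ (e k)) (E (e k))) φ r
    let single (e : Equiv.Perm (Fin n)) (r : Fin n) : ℂ :=
      (C (e r)).prob (σ (e r)) (E (e r)) (updated e r)
    (∀ e : Equiv.Perm (Fin n), MeasurementQFT.CausallyOrdered X (fun k ↦ K (e k)) →
      (∀ r : Fin n, (∀ s : Fin n, s < r → single e s ≠ 0) →
        MeasurementQFT.IsState (updated e r)) ∧
      joint = ∏ r : Fin n, single e r) ∧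
    (∀ e e' : Equiv.Perm (Fin n), MeasurementQFT.CausallyOrdered X (fun k ↦ K (e k)) →
      MeasurementQFT.CausallyOrdered X (fun k ↦ K (e' k)) →
      ∏ r : Fin n, single e r = ∏ r : Fin n, single e' r) := by
  intro joint updated single
  have key (e : Equiv.Perm (Fin n))
      (he : MeasurementQFT.CausallyOrdered X (fun k ↦ K (e k))) :
      (∀ r : Fin n, (∀ s : Fin n, s < r → single e s ≠ 0) →
        MeasurementQFT.IsState (updated e r)) ∧ joint = ∏ r : Fin n, single e r := by
    -- The probes at positions `0, …, r - 1` of the order `e`.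
    let T (r : ℕ) : Finset (Fin n) := Finset.univ.filter fun i ↦ (e.symm i).1 < r
    have hT0 : T 0 = ∅ := by simp [T]
    have hTn : T n = Finset.univ := by simp [T]
    have hTs (r : Fin n) : T (r + 1) = insert (e r) (T r) := by
      ext i
      simp only [T, Finset.mem_filter, Finset.mem_univ, true_and, Finset.mem_insert,
        ← Equiv.symm_apply_eq, Fin.ext_iff]
      omega
    -- The relation `◁` passes to unions in its left argument, so pairwise ordering gives the
    -- hypothesis of causal factorisation at each step.
    have hprec (r : Fin n) : MeasurementQFT.Precedes X (⋃ i ∈ T r, K i) (K (e r)) := by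
      refine Set.eq_empty_of_forall_notMem ?_
      rintro p ⟨hp, hp'⟩
      obtain ⟨i, hi, hpi⟩ := Set.mem_iUnion₂.1 hp
      have h := he (e.symm i) r (by simpa [T] using hi)
      simp only [Equiv.apply_symm_apply] at h
      exact Set.eq_empty_iff_forall_notMem.1 h p ⟨hpi, hp'⟩
    let ψ (r : ℕ) : Module.Dual ℂ A.alg := MeasurementQFT.mergedPreInstrument D σ E φ (T r)
    have hψ0 : ψ 0 = φ := by
      simp only [ψ, hT0, MeasurementQFT.mergedPreInstrument_empty]
    have hψs (r : Fin n) : ψ (r + 1) = (C (e r)).preInstrument (σ (e r)) (E (e r)) (ψ r) := by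
      have hr : e r ∉ T r := by simp [T]
      simp only [ψ, hTs]
      exact MeasurementQFT.mergedPreInstrument_insert D σ E φ hr (C (e r))
        (hCF (T r) (e r) hr (hprec r))
    have main := MeasurementQFT.iterate_eq_prod_smul (fun k ↦ C (e k)) hφ (fun k ↦ hσ (e k))
      (fun k ↦ hE (e k)) (updated e) rfl ψ hψ0 hψs
    refine ⟨fun r hr ↦ (main r r.2.le).1 hr, ?_⟩
    obtain ⟨hst, hψn⟩ := main n le_rfl
    have hjoint : joint = ψ n 1 := by
      simp only [ψ, hTn]
      rfl
    simp only [Fin.is_lt, Finset.filter_true, forall_const] at hst hψn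
    change (∀ s, single e s ≠ 0) → _ at hst
    change ψ n = (∏ s, single e s) • updated e n at hψn
    rw [hjoint, hψn, LinearMap.smul_apply, smul_eq_mul]
    -- When no factor vanishes, the last update is a state and equals `1` at `1`; otherwise the
    -- product is zero whatever the value of that update.
    by_cases h : ∀ s, single e s ≠ 0
    · rw [(hst h).map_one, mul_one]
    · push Not at h
      obtain ⟨s, hs⟩ := h
      rw [Finset.prod_eq_zero (Finset.mem_univ s) hs, zero_mul]
  exact ⟨key, fun e e' he he' ↦ (key e he).2.symm.trans (key e' he').2⟩
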